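/- Let $R$ be a nonzero associative ring with $1$, and let $J(R)$ be its Jacobson radical. Assume that $R$ is semiperfect (that is, $R/J(R)$ is semisimple and idempotents of $R/J(R)$ lift to idempotents of $R$) and that one of the following conditions holds: (1) $R$ is left and right noetherian; (2) $R$ is left and right perfect (that is, $R/J(R)$ is semisimple and $J(R)$ is left and right T-nilpotent: for every sequence $a_1,a_2,\dots$ in $J(R)$ there is $n$ with $a_1a_2\cdots a_n=0$, and there is $m$ with $a_m\cdots a_2a_1=0$), and the ring $R/J(R)^2$ is left and right noetherian. Then $R$ is indecomposable (that is, not isomorphic to a direct product of two nonzero rings) if and only if for any two simple right $R$-modules $S$ and $T$ there is an Ext-path from $S$ to $T$, that is, a finite sequence $S_1,\dots,S_k$ ($k\ge 1$) of simple right $R$-modules with $S_1\cong S$ and $S_k\cong T$ such that for every $i<k$ we have $\operatorname{Ext}^1_R(S_i,S_{i+1})\neq 0$ or $\operatorname{Ext}^1_R(S_{i+1},S_i)\neq 0$. -/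

import Mathlib

open CategoryTheory

universe u

/-- Idempotents of `R ⧸ J(R)` lift to idempotents of `R`. -/
def IdempotentsLiftModJacobson (R : Type u) [Ring R] : Prop :=
  ∀ x : R ⧸ Ring.jacobson R, IsIdempotentElem x →
    ∃ e : R, IsIdempotentElem e ∧ Ideal.Quotient.mk (Ring.jacobson R) e = x

/-- A ring is semiperfect if it is semilocal, i.e. `R ⧸ J(R)` is semisimple, and idempotents
lift modulo `J(R)`. -/
structure IsSemiperfectRing (R : Type u) [Ring R] : Prop where
  semilocal : IsSemisimpleRing (R ⧸ Ring.jacobson R)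
  lift : IdempotentsLiftModJacobson R

/-- Left T-nilpotence: for every sequence `a 0, a 1, …` in `I` some product
`a 0 * a 1 * ⋯ * a (n - 1)` vanishes. -/
def IsLeftTNilpotent {R : Type u} [Ring R] (I : Ideal R) : Prop :=
  ∀ a : ℕ → R, (∀ i, a i ∈ I) → ∃ n : ℕ, (List.ofFn fun i : Fin n => a i).prod = 0

/-- Right T-nilpotence: for every sequence `a 0, a 1, …` in `I` some product
`a (n - 1) * ⋯ * a 1 * a 0` vanishes. -/
def IsRightTNilpotent {R : Type u} [Ring R] (I : Ideal R) : Prop :=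
  ∀ a : ℕ → R, (∀ i, a i ∈ I) → ∃ n : ℕ, (List.ofFn fun i : Fin n => a i).reverse.prod = 0

/-- A ring is left perfect if `R ⧸ J(R)` is semisimple and `J(R)` is left T-nilpotent. -/
structure IsLeftPerfectRing (R : Type u) [Ring R] : Prop where
  semilocal : IsSemisimpleRing (R ⧸ Ring.jacobson R)
  tNilpotent : IsLeftTNilpotent (Ring.jacobson R)

/-- A ring is right perfect if `R ⧸ J(R)` is semisimple and `J(R)` is right T-nilpotent. -/
structure IsRightPerfectRing (R : Type u) [Ring R] : Prop where
  semilocal : IsSemisimpleRing (R ⧸ Ring.jacobson R)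
  tNilpotent : IsRightTNilpotent (Ring.jacobson R)

/-- `R` is left and right noetherian (a right `R`-module is a left `Rᵐᵒᵖ`-module). -/
def IsTwoSidedNoetherianRing (R : Type u) [Ring R] : Prop :=
  IsNoetherianRing R ∧ IsNoetherianRing Rᵐᵒᵖ

/-- A ring is indecomposable if it is nonzero and is not isomorphic to a direct product of two
nonzero rings. -/
def IsIndecomposableRing (R : Type u) [Ring R] : Prop :=
  Nontrivial R ∧ ∀ (A B : Type u) [Ring A] [Ring B] [Nontrivial A] [Nontrivial B],
    IsEmpty (R ≃+* A × B)

/-- There is an Ext-path from `S` to `T`, where `S` and `T` are modules over a ring `A`: a finite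
sequence `X 0, …, X k` of simple modules (`k = 0` is allowed) that begins with `S` and ends with
`T`, up to isomorphism, such that consecutive members have a nonzero `Ext¹` in at least one of the
two directions. -/
def HasExtPath {A : Type u} [Ring A] (S T : ModuleCat.{u} A) : Prop :=
  ∃ (k : ℕ) (X : Fin (k + 1) → ModuleCat.{u} A),
    (∀ i, IsSimpleModule A (X i)) ∧
    Nonempty (X 0 ≅ S) ∧ Nonempty (X (Fin.last k) ≅ T) ∧
    ∀ i : Fin k,
      Nontrivial (Abelian.Ext.{u} (X i.castSucc) (X i.succ) 1) ∨
        Nontrivial (Abelian.Ext.{u} (X i.succ) (X i.castSucc) 1)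

/-! Right modules are modules over `A = Rᵐᵒᵖ`. If `e` is a nontrivial central idempotent, it acts as
`0` or `1` on each simple module, both cases occur, and `Ext¹` vanishes between the two classes, so
no Ext-path joins them (`eq_zero_or_one_of_central_idempotent_of_hasExtPath`).

Conversely, suppose `T₀` cannot be reached from `S₀`. Some idempotent `e` acts as `1` on the simple
modules reachable from `S₀` and as `0` on the others (`exists_separating_idempotent`). The
off-diagonal corners of `e` lie in `J`, and since `Ext¹` vanishes between the classes they even lie
in `J²`: a corner element outside `J²` would survive in a simple quotient of `J/J²` and yield a
nonzero extension (`mul_mul_mem_jacobson_mul_self_of_subsingleton_ext`). The ideal `I` generated by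
such a corner then satisfies `I ≤ JI + IJ`, and Nakayama, or T-nilpotence on both sides, gives `I =
0` (`mul_mul_eq_zero_of_mem_jacobson_mul_self`). Hence `e` is central and splits the ring. -/

/-! ### `Ext¹` of cyclic modules, and dévissage. -/

section Ext

open Abelian

variable {A : Type u} [Ring A]

/-- As `A` is projective, `Ext¹(S, T)` is the cokernel of `Hom(A, T) → Hom(ker π, T)`, and every map
`A → T` has the form `a ↦ a • t`. -/
lemma subsingleton_ext_one_iff_extends (S T : ModuleCat.{u} A) (π : A →ₗ[A] S)
    (hπ : Function.Surjective π) :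
    Subsingleton (Ext.{u} S T 1) ↔
      ∀ f : LinearMap.ker π →ₗ[A] T, ∃ t : T, ∀ x : LinearMap.ker π, f x = (x : A) • t := by
  have hS := LinearMap.shortExact_shortComplexKer hπ
  have : Projective (ModuleCat.of A A) := inferInstance
  have : Projective (LinearMap.shortComplexKer π).X₂ := this
  constructor
  · intro hsub f
    obtain ⟨x₂, hx₂⟩ := Ext.contravariant_sequence_exact₁ hS T
      (Ext.mk₀ (ModuleCat.ofHom f)) (add_zero 1) (Subsingleton.elim _ _)
    obtain ⟨g, rfl⟩ := Ext.addEquiv₀.symm.surjective x₂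
    have hg : (LinearMap.shortComplexKer π).f ≫ g = ModuleCat.ofHom f := by
      apply Ext.addEquiv₀.symm.injective
      simpa using hx₂
    refine ⟨g.hom (1 : A), fun x => ?_⟩
    have := congr($(hg).hom x)
    rw [← map_smul]
    simp only [smul_eq_mul, mul_one]
    exact this.symm
  · intro h
    refine subsingleton_of_forall_eq 0 fun x => ?_
    obtain ⟨y, rfl⟩ := Ext.contravariant_sequence_exact₃ hS T x (Ext.eq_zero_of_projective _)
      (add_zero 1)
    obtain ⟨g, rfl⟩ := Ext.addEquiv₀.symm.surjective y
    obtain ⟨t, ht⟩ := h g.hom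
    have : g = (LinearMap.shortComplexKer π).f ≫
        ModuleCat.ofHom (LinearMap.toSpanSingleton A T t) := by
      ext x
      exact ht x
    rw [this, Ext.addEquiv₀_symm_apply, ← Ext.mk₀_comp_mk₀]
    exact hS.extClass_comp_assoc _

lemma subsingleton_ext_of_shortExact {S : ShortComplex (ModuleCat.{u} A)} (hS : S.ShortExact)
    (T : ModuleCat.{u} A) (n : ℕ) (h₁ : Subsingleton (Ext.{u} S.X₁ T n))
    (h₃ : Subsingleton (Ext.{u} S.X₃ T n)) : Subsingleton (Ext.{u} S.X₂ T n) := by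
  refine subsingleton_of_forall_eq 0 fun x => ?_
  obtain ⟨y, rfl⟩ := Ext.contravariant_sequence_exact₂ hS T x (Subsingleton.elim _ _)
  rw [Subsingleton.elim y 0, Ext.comp_zero]

lemma nontrivial_ext_of_iso {S S' T T' : ModuleCat.{u} A} (e : S ≅ S') (e' : T ≅ T') {n : ℕ}
    (h : Nontrivial (Ext.{u} S T n)) : Nontrivial (Ext.{u} S' T' n) := by
  have hinj : Function.Injective fun x : Ext.{u} S T n =>
      ((Ext.mk₀ e.inv).comp x (zero_add n)).comp (Ext.mk₀ e'.hom) (add_zero n) := by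
    apply Function.LeftInverse.injective
      (g := fun x => ((Ext.mk₀ e.hom).comp x (zero_add n)).comp (Ext.mk₀ e'.inv) (add_zero n))
    intro x
    simp
  exact hinj.nontrivial

/-- Dévissage along a composition series, whose factors are again killed by `f`. -/
lemma subsingleton_ext_of_isFiniteLength (T : ModuleCat.{u} A) (f : A) (n : ℕ)
    (h : ∀ S : ModuleCat.{u} A, IsSimpleModule A S → (∀ s : S, f • s = 0) →
      Subsingleton (Ext.{u} S T n))
    {M : Type u} [AddCommGroup M] [Module A M] (hM : IsFiniteLength A M)
    (hf : ∀ m : M, f • m = 0) : Subsingleton (Ext.{u} (ModuleCat.of A M) T n) := by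
  induction hM with
  | of_subsingleton =>
    rename_i M _ _ _
    have := ModuleCat.isZero_of_subsingleton (ModuleCat.of A M)
    have h0 : 𝟙 (ModuleCat.of A M) = 0 := this.eq_of_src _ _
    refine subsingleton_of_forall_eq 0 fun x => ?_
    rw [← Ext.mk₀_id_comp x, h0, Ext.mk₀_zero, Ext.zero_comp]
  | of_simple_quotient hN ih =>
    rename_i M _ _ N hsimple
    have hS := LinearMap.shortExact_shortComplexKer N.mkQ_surjective
    refine subsingleton_ext_of_shortExact hS T n ?_ ?_
    · change Subsingleton (Ext.{u} (ModuleCat.of A (LinearMap.ker N.mkQ)) T n)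
      rw [Submodule.ker_mkQ]
      exact ih fun m => Subtype.ext (hf m)
    · refine h (ModuleCat.of A (M ⧸ N)) hsimple fun s => ?_
      obtain ⟨m, rfl⟩ := N.mkQ_surjective s
      rw [← map_smul, hf, map_zero]

end Ext

/-! ### Left-right symmetry of the Jacobson radical. -/

section Jacobson

variable {R : Type u} [Ring R]

lemma mem_ringJacobson_iff_isUnit {x : R} :
    x ∈ Ring.jacobson R ↔ ∀ y, IsUnit (1 + y * x) := by
  have key : ∀ {x : R}, x ∈ Ring.jacobson R → ∃ z, z * (1 + x) = 1 := fun {x} hx => by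
    obtain ⟨z, hz⟩ := Ideal.mem_jacobson_iff.1 (Ideal.jacobson_bot (R := R) ▸ hx) 1
    refine ⟨z, ?_⟩
    have : z * 1 * x + z - 1 = 0 := hz
    rw [mul_one] at this
    rw [mul_add, mul_one, add_comm]
    exact sub_eq_zero.1 this
  constructor
  · intro hx y
    have hyx := Ideal.mul_mem_left _ y hx
    obtain ⟨z, hz⟩ := key hyx
    -- The left inverse `z` is itself `1` plus an element of the radical, so it has a left inverse
    -- too.
    have hz' : 1 + -(z * (y * x)) = z := by
      rw [← sub_eq_add_neg, sub_eq_iff_eq_add]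
      rw [← hz, mul_add, mul_one]
    obtain ⟨w, hw⟩ := key (neg_mem (Ideal.mul_mem_left _ z hyx))
    rw [hz'] at hw
    have hw' : w = 1 + y * x := left_inv_eq_right_inv hw hz
    exact ⟨⟨1 + y * x, z, hw' ▸ hw, hz⟩, rfl⟩
  · intro h
    rw [← Ideal.jacobson_bot, Ideal.mem_jacobson_iff]
    intro y
    obtain ⟨u, hu⟩ := h y
    refine ⟨(u⁻¹ : Rˣ), ?_⟩
    have : ((u⁻¹ : Rˣ) : R) * (1 + y * x) = 1 := by rw [← hu, Units.inv_mul]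
    rw [mul_add, mul_one, ← mul_assoc, add_comm] at this
    rw [this, sub_self]
    exact zero_mem _

lemma isUnit_one_add_mul_comm {x y : R} (h : IsUnit (1 + x * y)) : IsUnit (1 + y * x) := by
  obtain ⟨u, hu⟩ := h
  have h₁ : (1 + x * y) * ((u⁻¹ : Rˣ) : R) = 1 := by rw [← hu, Units.mul_inv]
  have h₂ : ((u⁻¹ : Rˣ) : R) * (1 + x * y) = 1 := by rw [← hu, Units.inv_mul]
  generalize ((u⁻¹ : Rˣ) : R) = z at h₁ h₂
  refine ⟨⟨1 + y * x, 1 - y * z * x, ?_, ?_⟩, rfl⟩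
  · calc (1 + y * x) * (1 - y * z * x) = 1 + y * x - y * ((1 + x * y) * z) * x := by noncomm_ring
      _ = 1 := by rw [h₁]; noncomm_ring
  · calc (1 - y * z * x) * (1 + y * x) = 1 + y * x - y * (z * (1 + x * y)) * x := by noncomm_ring
      _ = 1 := by rw [h₂]; noncomm_ring

lemma op_mem_ringJacobson {x : R} :
    MulOpposite.op x ∈ Ring.jacobson Rᵐᵒᵖ ↔ x ∈ Ring.jacobson R := by
  rw [mem_ringJacobson_iff_isUnit, mem_ringJacobson_iff_isUnit, MulOpposite.op_surjective.forall]
  refine forall_congr' fun y => ?_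
  have : (1 + MulOpposite.op y * MulOpposite.op x) = MulOpposite.op (1 + x * y) := rfl
  rw [this, isUnit_op]
  exact ⟨isUnit_one_add_mul_comm, isUnit_one_add_mul_comm⟩

lemma isSemisimpleRing_op_quotient_jacobson (h : IsSemisimpleRing (R ⧸ Ring.jacobson R)) :
    IsSemisimpleRing (Rᵐᵒᵖ ⧸ Ring.jacobson Rᵐᵒᵖ) := by
  rw [← isSemisimpleRing_mulOpposite_iff]
  let g : R →+* (Rᵐᵒᵖ ⧸ Ring.jacobson Rᵐᵒᵖ)ᵐᵒᵖ :=
    (RingHom.op (Ideal.Quotient.mk (Ring.jacobson Rᵐᵒᵖ))).comp (RingEquiv.opOp R).toRingHom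
  have hg : Function.Surjective g := by
    intro x
    obtain ⟨y, hy⟩ := Ideal.Quotient.mk_surjective x.unop
    exact ⟨y.unop, MulOpposite.unop_injective hy⟩
  have hker : ∀ a ∈ Ring.jacobson R, g a = 0 := fun a ha =>
    MulOpposite.unop_injective (Ideal.Quotient.eq_zero_iff_mem.2 (op_mem_ringJacobson.2 ha))
  refine RingHom.isSemisimpleRing_of_surjective (Ideal.Quotient.lift _ g hker) ?_
  exact Ideal.Quotient.lift_surjective_of_surjective _ hker hg

lemma exists_isIdempotentElem_op_of_lift (h : IdempotentsLiftModJacobson R) (a : Rᵐᵒᵖ)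
    (ha : a * a - a ∈ Ring.jacobson Rᵐᵒᵖ) :
    ∃ e, IsIdempotentElem e ∧ e - a ∈ Ring.jacobson Rᵐᵒᵖ := by
  obtain ⟨a, rfl⟩ := MulOpposite.op_surjective a
  obtain ⟨e, he, hea⟩ := h (Ideal.Quotient.mk _ a) (by
    rw [IsIdempotentElem, ← map_mul, Ideal.Quotient.mk_eq_mk_iff_sub_mem]
    exact op_mem_ringJacobson.1 ha)
  exact ⟨.op e, congrArg MulOpposite.op he,
    op_mem_ringJacobson.2 ((Ideal.Quotient.mk_eq_mk_iff_sub_mem _ _).1 hea)⟩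

end Jacobson

/-! ### Nakayama arguments: noetherian and T-nilpotent versions. -/

section Nakayama

variable {R : Type u} [Ring R]

lemma le_of_le_sup_jacobson_smul {M : Type*} [AddCommGroup M] [Module R M] [IsNoetherian R M]
    {N K : Submodule R M} (h : N ≤ K ⊔ Ring.jacobson R • N) : N ≤ K := by
  have hmap : N.map K.mkQ ≤ Ring.jacobson R • N.map K.mkQ := by
    rw [← Submodule.map_smul'']
    refine (Submodule.map_mono h).trans ?_
    rw [Submodule.map_sup, Submodule.mkQ_map_self, bot_sup_eq]
  have hbot : N.map K.mkQ = ⊥ := by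
    by_contra hne
    exact absurd (hmap.trans_lt ((IsNoetherian.noetherian _).jacobson_smul_lt hne)) (lt_irrefl _)
  rwa [← le_bot_iff, Submodule.map_le_iff_le_comap, Submodule.comap_bot,
    Submodule.ker_mkQ] at hbot

lemma le_of_le_sup_mul_jacobson_of_isNoetherian [IsNoetherianRing Rᵐᵒᵖ] {I K : Ideal R}
    [I.IsTwoSided] [K.IsTwoSided] (h : I ≤ K ⊔ I * Ring.jacobson R) : I ≤ K := by
  have : IsNoetherian Rᵐᵒᵖ R :=
    isNoetherian_of_linearEquiv
      ({ MulOpposite.opAddEquiv.symm with map_smul' := fun _ _ => rfl } : Rᵐᵒᵖ ≃ₗ[Rᵐᵒᵖ] R)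
  let toRight (I : Ideal R) [I.IsTwoSided] : Submodule Rᵐᵒᵖ R :=
    { I.toAddSubmonoid with smul_mem' := fun c x hx => I.mul_mem_right c.unop hx }
  have key : toRight I ≤ toRight K := by
    refine le_of_le_sup_jacobson_smul fun x hx => ?_
    obtain ⟨k, hk, y, hy, rfl⟩ := Submodule.mem_sup.1 (h hx)
    refine Submodule.add_mem_sup hk ?_
    refine Submodule.mul_induction_on hy (fun a ha b hb => ?_) fun a b => add_mem
    exact Submodule.smul_mem_smul (op_mem_ringJacobson.2 hb) (show a ∈ toRight I from ha)
  exact key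

/-- Dependent choice in the form that T-nilpotence needs: one sequence all of whose prefixes satisfy
`P`. -/
lemma exists_seq_forall_of_step {α : Type*} (P : List α → Prop) (s : Set α) (h0 : P [])
    (hstep : ∀ l, P l → ∃ a ∈ s, P (l ++ [a])) :
    ∃ a : ℕ → α, (∀ i, a i ∈ s) ∧ ∀ n, P (List.ofFn fun i : Fin n => a i) := by
  have : Nonempty α := ⟨(hstep [] h0).choose⟩
  choose! g hg hP using hstep
  let L : ℕ → List α := fun n => Nat.rec [] (fun _ l => l ++ [g l]) n
  have hL : ∀ n, P (L n) := fun n => by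
    induction n with
    | zero => exact h0
    | succ n ih => exact hP _ ih
  refine ⟨fun n => g (L n), fun i => hg _ (hL i), fun n => ?_⟩
  have : (List.ofFn fun i : Fin n => g (L i)) = L n := by
    induction n with
    | zero => rfl
    | succ n ih =>
      rw [List.ofFn_succ_last]
      simp only [Fin.val_castSucc, Fin.val_last]
      rw [ih]
  rw [this]
  exact hL n

lemma le_of_le_sup_mul_of_isRightTNilpotent {J : Ideal R} (hJ : IsRightTNilpotent J)
    {I K : Ideal R} [K.IsTwoSided] (h : I ≤ K ⊔ I * J) : I ≤ K := by
  by_contra hIK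
  -- If `x * p ∉ K` with `x ∈ I`, write `x` as an element of `K` plus a sum of products `u * v`;
  -- some `u * (v * p) ∉ K`, so the products never vanish.
  obtain ⟨a, haJ, ha⟩ := exists_seq_forall_of_step
    (fun l : List R => ∃ x ∈ I, x * l.reverse.prod ∉ K) J
    (by simpa using Set.not_subset.1 hIK) (by
      rintro l ⟨x, hx, hxl⟩
      by_contra! hcon
      refine hxl ?_
      obtain ⟨k, hk, y, hy, rfl⟩ := Submodule.mem_sup.1 (h hx)
      rw [add_mul]
      refine add_mem (K.mul_mem_right _ hk) ?_
      refine Submodule.mul_induction_on hy (fun u hu v hv => ?_) fun u v hu hv => ?_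
      · have := hcon v hv u hu
        simpa [mul_assoc] using this
      · rw [add_mul]
        exact add_mem hu hv)
  obtain ⟨n, hn⟩ := hJ a haJ
  obtain ⟨x, -, hx⟩ := ha n
  rw [hn, mul_zero] at hx
  exact hx (zero_mem _)

lemma le_of_le_sup_mul_of_isLeftTNilpotent {J : Ideal R} (hJ : IsLeftTNilpotent J)
    {I K : Ideal R} (h : I ≤ K ⊔ J * I) : I ≤ K := by
  by_contra hIK
  obtain ⟨a, haJ, ha⟩ := exists_seq_forall_of_step
    (fun l : List R => ∃ x ∈ I, l.prod * x ∉ K) J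
    (by simpa using Set.not_subset.1 hIK) (by
      rintro l ⟨x, hx, hxl⟩
      by_contra! hcon
      refine hxl ?_
      obtain ⟨k, hk, y, hy, rfl⟩ := Submodule.mem_sup.1 (h hx)
      rw [mul_add]
      refine add_mem (K.mul_mem_left _ hk) ?_
      refine Submodule.mul_induction_on hy (fun u hu v hv => ?_) fun u v hu hv => ?_
      · have := hcon u hu v hv
        simpa [mul_assoc] using this
      · rw [mul_add]
        exact add_mem hu hv)
  obtain ⟨n, hn⟩ := hJ a haJ
  obtain ⟨x, -, hx⟩ := ha n
  rw [hn, zero_mul] at hx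
  exact hx (zero_mem _)

/-- The two sides are removed in turn: `IJ` modulo `K = JI`, then `JI` modulo `K = 0`. -/
lemma eq_bot_of_le_jacobson_mul_sup_mul_jacobson
    (h : IsTwoSidedNoetherianRing R ∨ (IsLeftPerfectRing R ∧ IsRightPerfectRing R))
    {I : Ideal R} [I.IsTwoSided] (hI : I ≤ Ring.jacobson R * I ⊔ I * Ring.jacobson R) :
    I = ⊥ := by
  rcases h with ⟨hl, hr⟩ | ⟨hl, hr⟩
  · have h₁ : I ≤ Ring.jacobson R * I := le_of_le_sup_mul_jacobson_of_isNoetherian hI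
    exact le_bot_iff.1 (le_of_le_sup_jacobson_smul (h₁.trans le_sup_right))
  · have h₁ : I ≤ Ring.jacobson R * I := le_of_le_sup_mul_of_isRightTNilpotent hr.tNilpotent hI
    exact le_bot_iff.1
      (le_of_le_sup_mul_of_isLeftTNilpotent hl.tNilpotent (h₁.trans le_sup_right))

/-- If `1 = e + f` and `e R f ⊆ J(R) ^ 2`, then `e R f = 0`. -/
lemma mul_mul_eq_zero_of_mem_jacobson_mul_self
    (h : IsTwoSidedNoetherianRing R ∨ (IsLeftPerfectRing R ∧ IsRightPerfectRing R))
    {e f : R} (he : IsIdempotentElem e) (hf : IsIdempotentElem f) (hef : e + f = 1)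
    (hmul : ∀ r, e * r * f ∈ Ring.jacobson R * Ring.jacobson R) (r : R) :
    e * r * f = 0 := by
  let I : Ideal R :=
    (TwoSidedIdeal.span {x | ∃ r, x = e * r * f}).asIdeal
  have hmem : ∀ r, e * r * f ∈ I := fun r =>
    TwoSidedIdeal.mem_asIdeal.2 (TwoSidedIdeal.subset_span ⟨r, rfl⟩)
  have key : I ≤ Ring.jacobson R * I ⊔ I * Ring.jacobson R := by
    intro x hx
    have : (Ring.jacobson R * I ⊔ I * Ring.jacobson R).IsTwoSided := ⟨fun b hx => by
      obtain ⟨y, hy, z, hz, rfl⟩ := Submodule.mem_sup.1 hx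
      rw [add_mul]
      exact Submodule.add_mem_sup (Ideal.mul_mem_right b _ hy) (Ideal.mul_mem_right b _ hz)⟩
    have hle : TwoSidedIdeal.span {x | ∃ r, x = e * r * f} ≤
        (Ring.jacobson R * I ⊔ I * Ring.jacobson R).toTwoSided := by
      rw [TwoSidedIdeal.span_le]
      rintro _ ⟨r, rfl⟩
      rw [SetLike.mem_coe, Ideal.mem_toTwoSided]
      have hsplit : e * r * f = e * (e * r * f) * f := by
        rw [show e * (e * r * f) * f = (e * e) * r * (f * f) by noncomm_ring, he.eq, hf.eq]
      rw [hsplit]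
      refine Submodule.mul_induction_on
        (C := fun y => e * y * f ∈ Ring.jacobson R * I ⊔ I * Ring.jacobson R)
        (hmul r) (fun a ha b hb => ?_) fun a b ha hb => ?_
      -- Inserting `1 = e + f` between `a` and `b` puts one summand in `JI` and the other in `IJ`.
      · have : e * (a * b) * f = e * a * (e * b * f) + e * a * f * (b * f) := by
          calc e * (a * b) * f = e * a * (e + f) * b * f := by rw [hef]; noncomm_ring
            _ = e * a * (e * b * f) + e * a * f * (b * f) := by noncomm_ring
        rw [this]
        exact Submodule.add_mem_sup
          (Ideal.mul_mem_mul (Ideal.mul_mem_left _ e ha) (hmem b))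
          (Ideal.mul_mem_mul (hmem a) (Ideal.mul_mem_right f _ hb))
      · rw [mul_add, add_mul]
        exact add_mem ha hb
    exact Ideal.mem_toTwoSided.1 (hle (TwoSidedIdeal.mem_asIdeal.1 hx))
  have := eq_bot_of_le_jacobson_mul_sup_mul_jacobson h key
  exact (Submodule.mem_bot R).1 (this ▸ hmem r)

end Nakayama

/-! ### Separating idempotents, and corners inside `J²`. -/

section Separation

open Abelian

variable {A : Type u} [Ring A]

lemma IsSimpleModule.smul_mem_ringJacobson_eq_zero {S : Type*} [AddCommGroup S] [Module A S]
    [IsSimpleModule A S] {j : A} (hj : j ∈ Ring.jacobson A) (s : S) : j • s = 0 :=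
  Module.mem_annihilator.1 (IsSemisimpleModule.jacobson_le_annihilator A S hj) s

lemma mem_ringJacobson_of_forall_simple_smul_eq_zero {a : A}
    (h : ∀ S : ModuleCat.{u} A, IsSimpleModule A S → ∀ s : S, a • s = 0) :
    a ∈ Ring.jacobson A := by
  refine Submodule.mem_sInf.2 fun m hm => ?_
  have := h (ModuleCat.of A (A ⧸ m)) (isSimpleModule_iff_isCoatom.2 hm) (m.mkQ 1)
  rw [← map_smul, smul_eq_mul, mul_one] at this
  exact (Submodule.Quotient.mk_eq_zero m).1 this

lemma isSemisimpleModule_of_jacobson_smul_eq_zero (h : IsSemisimpleRing (A ⧸ Ring.jacobson A))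
    {M : Type*} [AddCommGroup M] [Module A M]
    (hM : ∀ j ∈ Ring.jacobson A, ∀ m : M, j • m = 0) : IsSemisimpleModule A M := by
  have htor : Module.IsTorsionBySet A M (Ring.jacobson A) := fun m j => hM j j.2 m
  have := htor.isSemisimpleModule_iff
  exact this.1 (letI := htor.module; inferInstance)

/-- A class of simple modules over a semilocal ring is singled out by an element acting as `1` on
its members and as `0` on the other simple modules. -/
lemma exists_separating_element (h : IsSemisimpleRing (A ⧸ Ring.jacobson A))
    (P : ModuleCat.{u} A → Prop) (hP : ∀ S T : ModuleCat.{u} A, (S ≅ T) → P S → P T) :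
    ∃ a : A, ∀ S : ModuleCat.{u} A, IsSimpleModule A S →
      (P S → ∀ s : S, a • s = s) ∧ (¬ P S → ∀ s : S, a • s = 0) := by
  have hss : IsSemisimpleModule A (A ⧸ Ring.jacobson A) :=
    isSemisimpleModule_of_jacobson_smul_eq_zero h fun j hj m => by
      obtain ⟨x, rfl⟩ := (Ring.jacobson A).mkQ_surjective m
      rw [← map_smul]
      exact (Submodule.Quotient.mk_eq_zero _).2 (Ideal.mul_mem_right _ _ hj)
  -- The sums of the simple submodules inside and outside the class. By Schur, neither maps
  -- nontrivially to a simple module of the other kind; `a` represents the component of `1` in `I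
  -- True`.
  let I (p : Prop) : Submodule A (A ⧸ Ring.jacobson A) :=
    sSup {N | IsSimpleModule A N ∧ (P (ModuleCat.of A N) ↔ p)}
  have htop : I True ⊔ I False = ⊤ := by
    rw [eq_top_iff, ← IsSemisimpleModule.sSup_simples_eq_top A (A ⧸ Ring.jacobson A)]
    refine sSup_le fun N hN => ?_
    by_cases hPN : P (ModuleCat.of A N)
    · exact le_sup_of_le_left (le_sSup ⟨hN, by simpa⟩)
    · exact le_sup_of_le_right (le_sSup ⟨hN, by simpa⟩)
  have hker : ∀ (p : Prop) (S : ModuleCat.{u} A), IsSimpleModule A S → ¬(P S ↔ p) →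
      ∀ φ : (A ⧸ Ring.jacobson A) →ₗ[A] S, ∀ x ∈ I p, φ x = 0 := by
    intro p S hS hPS φ
    suffices I p ≤ LinearMap.ker φ from fun x hx => this hx
    refine sSup_le fun N ⟨hN, hPN⟩ x hx => ?_
    rcases LinearMap.bijective_or_eq_zero (φ ∘ₗ N.subtype) with hb | h0
    · exact absurd ⟨fun h' => hPN.1 (hP _ _ (LinearEquiv.ofBijective _ hb).toModuleIso.symm h'),
        fun h' => hP _ _ (LinearEquiv.ofBijective _ hb).toModuleIso (hPN.2 h')⟩ hPS
    · exact congr($h0 ⟨x, hx⟩)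
  obtain ⟨x, hx, y, hy, hxy⟩ := Submodule.mem_sup.1
    (show (Ring.jacobson A).mkQ 1 ∈ I True ⊔ I False from htop ▸ Submodule.mem_top)
  obtain ⟨a, rfl⟩ := (Ring.jacobson A).mkQ_surjective x
  refine ⟨a, fun S hS => ?_⟩
  let φ (s : S) : (A ⧸ Ring.jacobson A) →ₗ[A] S :=
    (Ring.jacobson A).liftQ (LinearMap.toSpanSingleton A S s) fun j hj =>
      IsSimpleModule.smul_mem_ringJacobson_eq_zero hj s
  have hφ : ∀ s b, φ s ((Ring.jacobson A).mkQ b) = b • s := fun s b => rfl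
  refine ⟨fun hPS s => ?_, fun hPS s => ?_⟩
  · have := congrArg (φ s) hxy
    rwa [map_add, hker False S hS (by simpa) (φ s) y hy, add_zero, hφ, hφ, one_smul] at this
  · rw [← hφ, hker True S hS (by simpa) (φ s) _ hx]

/-- A separating element lifts to an idempotent if idempotents lift modulo `J(A)`. -/
lemma exists_separating_idempotent (h : IsSemisimpleRing (A ⧸ Ring.jacobson A))
    (hlift : ∀ a : A, a * a - a ∈ Ring.jacobson A →
      ∃ e, IsIdempotentElem e ∧ e - a ∈ Ring.jacobson A)
    (P : ModuleCat.{u} A → Prop) (hP : ∀ S T : ModuleCat.{u} A, (S ≅ T) → P S → P T) :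
    ∃ e : A, IsIdempotentElem e ∧ ∀ S : ModuleCat.{u} A, IsSimpleModule A S →
      (P S → ∀ s : S, e • s = s) ∧ (¬ P S → ∀ s : S, e • s = 0) := by
  obtain ⟨a, ha⟩ := exists_separating_element h P hP
  obtain ⟨e, he, hea⟩ := hlift a (mem_ringJacobson_of_forall_simple_smul_eq_zero fun S hS s => by
    rw [sub_smul, mul_smul]
    by_cases hPS : P S
    · simp [(ha S hS).1 hPS]
    · simp [(ha S hS).2 hPS])
  refine ⟨e, he, fun S hS => ?_⟩
  have : ∀ s : S, e • s = a • s := fun s => by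
    rw [← sub_eq_zero, ← sub_smul]
    exact IsSimpleModule.smul_mem_ringJacobson_eq_zero hea s
  simpa only [this] using ha S hS

lemma exists_simple_quotient_ne_zero {M : Type u} [AddCommGroup M] [Module A M]
    [IsSemisimpleModule A M] {x : M} (hx : x ≠ 0) :
    ∃ (T : ModuleCat.{u} A) (φ : M →ₗ[A] T), IsSimpleModule A T ∧ φ x ≠ 0 := by
  have : x ∉ Module.jacobson A M := by
    rwa [IsSemisimpleModule.jacobson_eq_bot]
  rw [Module.jacobson, Submodule.mem_sInf] at this
  push Not at this
  obtain ⟨m, hm, hxm⟩ := this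
  exact ⟨ModuleCat.of A (M ⧸ m), m.mkQ, isSimpleModule_iff_isCoatom.2 hm,
    fun h => hxm ((Submodule.Quotient.mk_eq_zero m).1 h)⟩

/-- Vanishing of `Ext¹` between the simple modules on which `f` acts as `0` and those on which it
acts as `1` forces `f A e ⊆ J(A) ^ 2`. -/
lemma mul_mul_mem_jacobson_mul_self_of_subsingleton_ext (h : IsSemisimpleRing (A ⧸ Ring.jacobson A))
    {e f : A} (hf : IsIdempotentElem f) (hef : e + f = 1)
    (hfe : ∀ r, f * r * e ∈ Ring.jacobson A)
    (hact : ∀ S : ModuleCat.{u} A, IsSimpleModule A S →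
      (∀ s : S, f • s = s) ∨ (∀ s : S, f • s = 0))
    (hext : ∀ S T : ModuleCat.{u} A, IsSimpleModule A S → IsSimpleModule A T →
      (∀ s : S, f • s = 0) → (∀ t : T, f • t = t) → Subsingleton (Ext.{u} S T 1))
    (r : A) : f * r * e ∈ Ring.jacobson A * Ring.jacobson A := by
  set J := Ring.jacobson A with hJ
  by_contra hmem
  have hfe0 : f * e = 0 := by
    have : f * (e + f) = f := by rw [hef, mul_one]
    rwa [mul_add, hf.eq, add_eq_right] at this
  let N : Submodule A J := Submodule.comap J.subtype (J * J)
  have hss : IsSemisimpleModule A (J ⧸ N) :=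
    isSemisimpleModule_of_jacobson_smul_eq_zero h fun i hi m => by
      obtain ⟨x, rfl⟩ := N.mkQ_surjective m
      rw [← map_smul]
      exact (Submodule.Quotient.mk_eq_zero _).2 (Ideal.mul_mem_mul hi x.2)
  have hfre : f * r * e ∈ J := hfe r
  have hne : N.mkQ ⟨f * r * e, hfre⟩ ≠ 0 := fun h0 =>
    hmem ((Submodule.Quotient.mk_eq_zero N).1 h0)
  obtain ⟨T, φ, hT, hφ⟩ := exists_simple_quotient_ne_zero (A := A) hne
  have hfT : ∀ t : T, f • t = t := by
    refine (hact T hT).resolve_right fun h0 => hφ ?_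
    rw [show (⟨f * r * e, hfre⟩ : J) = f • ⟨f * r * e, hfre⟩ from Subtype.ext (by
      simp only [SetLike.mk_smul_mk, smul_eq_mul, ← mul_assoc, hf.eq]), map_smul, map_smul, h0]
  -- `A ⧸ K` is the cyclic submodule of `A ⧸ J` generated by the class of `e`; it is killed by `f`
  -- because `f A e ⊆ J`.
  let ρ : A →ₗ[A] A ⧸ J := J.mkQ ∘ₗ LinearMap.toSpanSingleton A A e
  let K : Ideal A := LinearMap.ker ρ
  have hK : ∀ y, y ∈ K ↔ y * e ∈ J := fun y => Submodule.Quotient.mk_eq_zero J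
  have hJK : J ≤ K := fun y hy => (hK y).2 (Ideal.mul_mem_right _ _ hy)
  have hfl : IsFiniteLength A (A ⧸ K) := by
    have : IsSemisimpleModule A (A ⧸ K) :=
      isSemisimpleModule_of_jacobson_smul_eq_zero h fun i hi m => by
        obtain ⟨x, rfl⟩ := K.mkQ_surjective m
        rw [← map_smul]
        exact (Submodule.Quotient.mk_eq_zero _).2 (hJK (Ideal.mul_mem_right _ _ hi))
    have hiff : Module.Finite A (A ⧸ K) ↔ IsFiniteLength A (A ⧸ K) :=
      IsSemisimpleModule.finite_tfae.out 0 3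
    exact hiff.1 inferInstance
  have hsub : Subsingleton (Ext.{u} (ModuleCat.of A (A ⧸ K)) T 1) := by
    refine subsingleton_ext_of_isFiniteLength T f 1 (fun S hS hfS => hext S T hS hT hfS hfT) hfl
      fun m => ?_
    obtain ⟨x, rfl⟩ := K.mkQ_surjective m
    rw [← map_smul]
    exact (Submodule.Quotient.mk_eq_zero _).2 ((hK _).2 (hfe x))
  have hkerK : ∀ x : LinearMap.ker K.mkQ, (x : A) * e ∈ J := fun x =>
    (hK _).1 ((Submodule.Quotient.mk_eq_zero K).1 x.2)
  -- The map `y ↦ φ(ye)` must be `y ↦ y • t`. At `y = f` it gives `t = f • t = φ(fe) = 0`, and then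
  -- at `y = fr` it contradicts `φ(fre) ≠ 0`.
  let g : LinearMap.ker K.mkQ →ₗ[A] T := φ ∘ₗ N.mkQ ∘ₗ
    LinearMap.codRestrict J (LinearMap.toSpanSingleton A A e ∘ₗ Submodule.subtype _) hkerK
  obtain ⟨t, ht⟩ := (subsingleton_ext_one_iff_extends _ T K.mkQ K.mkQ_surjective).1 hsub g
  have hmemker : ∀ y, y * e ∈ J → y ∈ LinearMap.ker K.mkQ := fun y hy =>
    (Submodule.Quotient.mk_eq_zero K).2 ((hK y).2 hy)
  have hg : ∀ y (hy : y * e ∈ J), φ (N.mkQ ⟨y * e, hy⟩) = y • t := fun y hy =>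
    ht ⟨y, hmemker y hy⟩
  have ht0 : t = 0 := by
    have hfe' : f * e ∈ J := by rw [hfe0]; exact zero_mem _
    rw [← hfT t, ← hg f hfe']
    rw [show (⟨f * e, hfe'⟩ : J) = 0 from Subtype.ext hfe0, map_zero, map_zero]
  refine hφ ?_
  rw [hg (f * r) hfre, ht0, smul_zero]

end Separation

/-! ### Product decompositions and central idempotents. -/

section Decomposition

variable {R : Type u} [Ring R]

lemma not_isIndecomposableRing_of_central_idempotent {e : R} (he : IsIdempotentElem e)
    (hc : ∀ r, e * r = r * e) (h0 : e ≠ 0) (h1 : e ≠ 1) : ¬ IsIndecomposableRing R := by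
  rintro ⟨-, h⟩
  let E : Fin 2 → R := ![e, 1 - e]
  have hE : CompleteOrthogonalIdempotents E := by
    refine ⟨⟨fun i => ?_, fun i j hij => ?_⟩, ?_⟩
    · fin_cases i
      exacts [he, he.one_sub]
    · fin_cases i <;> fin_cases j
      · exact absurd rfl hij
      · exact he.mul_one_sub_self
      · exact he.one_sub_mul_self
      · exact absurd rfl hij
    · simp [E]
  have hEc : ∀ i, IsMulCentral (E i) := fun i => by
    refine Semigroup.mem_center_iff.2 fun r => ?_
    fin_cases i
    · exact (hc r).symm
    · change r * (1 - e) = (1 - e) * r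
      rw [mul_sub, sub_mul, one_mul, mul_one, hc]
  have hne : ∀ i, E i ≠ 0 := fun i => by
    fin_cases i
    exacts [h0, sub_ne_zero.2 h1.symm]
  have hnt : ∀ i, Nontrivial (hE.idem i).Corner := fun i =>
    ⟨1, 0, fun h => hne i (congrArg Subtype.val h)⟩
  have := hnt 0
  have := hnt 1
  exact (h _ _).false ((hE.ringEquivOfIsMulCentral hEc).trans (RingEquiv.piFinTwo _))

lemma exists_central_idempotent_of_not_isIndecomposableRing [Nontrivial R]
    (h : ¬ IsIndecomposableRing R) :
    ∃ e : R, IsIdempotentElem e ∧ (∀ r, e * r = r * e) ∧ e ≠ 0 ∧ e ≠ 1 := by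
  unfold IsIndecomposableRing at h
  push Not at h
  obtain ⟨A, B, _, _, _, _, ⟨φ⟩⟩ := h inferInstance
  refine ⟨φ.symm (1, 0), ?_, fun r => ?_, ?_, ?_⟩
  · rw [IsIdempotentElem, ← map_mul]
    simp
  · apply φ.injective
    simp [Prod.ext_iff]
  · simp
  · rw [Ne, ← φ.injective.eq_iff]
    simp

end Decomposition

/-! ### Ext-paths and the action of central idempotents. -/

section ExtPath

open Abelian

variable {A : Type u} [Ring A]

lemma HasExtPath.of_iso {S T : ModuleCat.{u} A} (e : S ≅ T) (hS : IsSimpleModule A S) :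
    HasExtPath S T :=
  ⟨0, fun _ => S, fun _ => hS, ⟨Iso.refl _⟩, ⟨e⟩, fun i => i.elim0⟩

lemma HasExtPath.trans_iso {S T T' : ModuleCat.{u} A} (h : HasExtPath S T) (e : T ≅ T') :
    HasExtPath S T' := by
  obtain ⟨k, X, hX, h0, ⟨hl⟩, hext⟩ := h
  exact ⟨k, X, hX, h0, ⟨hl ≪≫ e⟩, hext⟩

lemma HasExtPath.snoc {S T T' : ModuleCat.{u} A} (h : HasExtPath S T) (hT' : IsSimpleModule A T')
    (hext : Nontrivial (Ext.{u} T T' 1) ∨ Nontrivial (Ext.{u} T' T 1)) : HasExtPath S T' := by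
  obtain ⟨k, X, hX, ⟨h0⟩, ⟨hl⟩, hX'⟩ := h
  refine ⟨k + 1, Fin.snoc X T', fun i => ?_, ⟨?_⟩, ⟨?_⟩, fun i => ?_⟩
  · induction i using Fin.lastCases with
    | last => rwa [Fin.snoc_last (α := fun _ => ModuleCat.{u} A)]
    | cast i =>
      rw [Fin.snoc_castSucc (α := fun _ => ModuleCat.{u} A)]
      exact hX i
  · refine eqToIso ?_ ≪≫ h0
    rw [← Fin.castSucc_zero, Fin.snoc_castSucc (α := fun _ => ModuleCat.{u} A)]
  · exact eqToIso (Fin.snoc_last (α := fun _ => ModuleCat.{u} A) _ _)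
  · induction i using Fin.lastCases with
    | last =>
      simp only [Fin.succ_last, Fin.snoc_last, Fin.snoc_castSucc]
      exact hext.imp (nontrivial_ext_of_iso hl.symm (Iso.refl _))
        (nontrivial_ext_of_iso (Iso.refl _) hl.symm)
    | cast i =>
      simp only [Fin.succ_castSucc, Fin.snoc_castSucc]
      exact hX' i

lemma HasExtPath.induction {P : ModuleCat.{u} A → Prop}
    (hiso : ∀ S T : ModuleCat.{u} A, (S ≅ T) → P S → P T)
    (hext : ∀ S T : ModuleCat.{u} A, IsSimpleModule A S → IsSimpleModule A T →
      (Nontrivial (Ext.{u} S T 1) ∨ Nontrivial (Ext.{u} T S 1)) → P S → P T)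
    {S T : ModuleCat.{u} A} (h : HasExtPath S T) (hS : P S) : P T := by
  obtain ⟨k, X, hX, ⟨h0⟩, ⟨hl⟩, hX'⟩ := h
  refine hiso _ _ hl ?_
  have key : ∀ i, P (X i) := fun i => by
    induction i using Fin.induction with
    | zero => exact hiso _ _ h0.symm hS
    | succ i ih => exact hext _ _ (hX _) (hX _) (hX' i) ih
  exact key _

/-- Multiplication by a central element is an endomorphism, so Schur applies. -/
lemma IsSimpleModule.central_idempotent_smul {S : Type*} [AddCommGroup S] [Module A S]
    [IsSimpleModule A S] {e : A} (he : IsIdempotentElem e) (hc : ∀ r, e * r = r * e) :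
    (∀ s : S, e • s = s) ∨ (∀ s : S, e • s = 0) := by
  let φ : S →ₗ[A] S :=
    { toFun := fun s => e • s
      map_add' := smul_add e
      map_smul' := fun r s => by simp only [← mul_smul, hc, RingHom.id_apply] }
  rcases LinearMap.bijective_or_eq_zero φ with hb | h0
  · exact Or.inl fun s => hb.1 (show e • e • s = e • s by rw [← mul_smul, he.eq])
  · exact Or.inr fun s => congr($h0 s)

lemma subsingleton_ext_one_of_central {e : A} (hc : ∀ r, e * r = r * e)
    {S T : ModuleCat.{u} A} (hS : IsSimpleModule A S) (heS : ∀ s : S, e • s = 0)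
    (heT : ∀ t : T, e • t = t) : Subsingleton (Ext.{u} S T 1) := by
  have := IsSimpleModule.nontrivial A S
  obtain ⟨s, hs⟩ := exists_ne (0 : S)
  refine (subsingleton_ext_one_iff_extends S T (LinearMap.toSpanSingleton A S s)
    (IsSimpleModule.toSpanSingleton_surjective A hs)).2 fun f => ?_
  -- The kernel contains `e`, and `f x = e • f x = f (e * x) = f (x * e) = x • f e`.
  refine ⟨f ⟨e, heS s⟩, fun x => ?_⟩
  rw [← heT (f x), ← map_smul, ← map_smul]
  exact congrArg f (Subtype.ext (hc x))

lemma exists_simple_central_idempotent_smul_eq_zero {e : A} (he : IsIdempotentElem e)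
    (hc : ∀ r, e * r = r * e) (h1 : e ≠ 1) :
    ∃ S : ModuleCat.{u} A, IsSimpleModule A S ∧ ∀ s : S, e • s = 0 := by
  have hne : Ideal.span {e} ≠ ⊤ := fun h => by
    obtain ⟨r, hr⟩ := Ideal.mem_span_singleton'.1 ((Ideal.eq_top_iff_one _).1 h)
    refine h1 ?_
    calc e = r * e * e := by rw [hr, one_mul]
      _ = 1 := by rw [mul_assoc, he.eq, hr]
  obtain ⟨m, hm, hle⟩ := Ideal.exists_le_maximal _ hne
  refine ⟨ModuleCat.of A (A ⧸ m), isSimpleModule_iff_isCoatom.2 (Ideal.isMaximal_def.1 hm),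
    fun s => ?_⟩
  obtain ⟨x, rfl⟩ := m.mkQ_surjective s
  rw [← map_smul]
  refine (Submodule.Quotient.mk_eq_zero m).2 ?_
  rw [smul_eq_mul, hc]
  exact m.mul_mem_left x (hle (Ideal.mem_span_singleton_self e))

lemma eq_zero_or_one_of_central_idempotent_of_hasExtPath
    (h : ∀ S T : ModuleCat.{u} A, IsSimpleModule A S → IsSimpleModule A T → HasExtPath S T)
    {e : A} (he : IsIdempotentElem e) (hc : ∀ r, e * r = r * e) : e = 0 ∨ e = 1 := by
  by_contra! hne
  have hc' : ∀ r, (1 - e) * r = r * (1 - e) := fun r => by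
    rw [sub_mul, mul_sub, one_mul, mul_one, hc]
  obtain ⟨S, hS, heS⟩ := exists_simple_central_idempotent_smul_eq_zero he hc hne.2
  obtain ⟨T, hT, heT⟩ := exists_simple_central_idempotent_smul_eq_zero he.one_sub hc'
    (by simpa using hne.1)
  -- Being killed by `e` passes along every edge; the two directions of `Ext¹` use `e` and `1 - e`.
  have hT0 : ∀ t : T, e • t = 0 := by
    refine HasExtPath.induction (P := fun X => ∀ x : X, e • x = 0) (fun X Y i hX y => ?_)
      (fun X Y hXs hYs hext hX => ?_) (h S T hS hT) heS
    · have := congrArg i.hom.hom (hX (i.inv.hom y))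
      rw [map_smul, map_zero] at this
      rwa [show i.hom.hom (i.inv.hom y) = y from congr($(i.inv_hom_id).hom y)] at this
    · refine (IsSimpleModule.central_idempotent_smul he hc).resolve_left fun hY => ?_
      rcases hext with hext | hext
      · exact not_subsingleton_iff_nontrivial.2 hext
          (subsingleton_ext_one_of_central hc hXs hX hY)
      · refine not_subsingleton_iff_nontrivial.2 hext
          (subsingleton_ext_one_of_central hc' hYs (fun y => ?_) fun x => ?_)
        · rw [sub_smul, hY, one_smul, sub_self]
        · rw [sub_smul, hX, one_smul, sub_zero]
  have := IsSimpleModule.nontrivial A T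
  obtain ⟨t, ht⟩ := exists_ne (0 : T)
  refine ht ?_
  have := heT t
  rwa [sub_smul, one_smul, hT0, sub_zero] at this

end ExtPath

/-! ### Transfer from `Rᵐᵒᵖ` to `R`, and the theorem. -/

section Main

open Abelian

variable {R : Type u} [Ring R]

lemma unop_mem_ringJacobson_mul_self {x : Rᵐᵒᵖ}
    (hx : x ∈ Ring.jacobson Rᵐᵒᵖ * Ring.jacobson Rᵐᵒᵖ) :
    x.unop ∈ Ring.jacobson R * Ring.jacobson R := by
  refine Submodule.mul_induction_on hx (fun a ha b hb => ?_) fun a b ha hb => add_mem ha hb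
  exact Ideal.mul_mem_mul (op_mem_ringJacobson.1 hb) (op_mem_ringJacobson.1 ha)

lemma unop_mul_mul_unop_eq_zero_of_subsingleton_ext
    (hR : IsTwoSidedNoetherianRing R ∨ (IsLeftPerfectRing R ∧ IsRightPerfectRing R))
    (h : IsSemisimpleRing (R ⧸ Ring.jacobson R))
    {e f : Rᵐᵒᵖ} (he : IsIdempotentElem e) (hf : IsIdempotentElem f) (hef : e + f = 1)
    (hact : ∀ S : ModuleCat.{u} Rᵐᵒᵖ, IsSimpleModule Rᵐᵒᵖ S →
      (∀ s : S, f • s = s) ∨ (∀ s : S, f • s = 0))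
    (hext : ∀ S T : ModuleCat.{u} Rᵐᵒᵖ, IsSimpleModule Rᵐᵒᵖ S → IsSimpleModule Rᵐᵒᵖ T →
      (∀ s : S, f • s = 0) → (∀ t : T, f • t = t) → Subsingleton (Ext.{u} S T 1)) (r : R) :
    e.unop * r * f.unop = 0 := by
  -- On each simple module either `f` or `e = 1 - f` acts as `0`, so `f x e` kills it.
  have hfe : ∀ x, f * x * e ∈ Ring.jacobson Rᵐᵒᵖ := fun x =>
    mem_ringJacobson_of_forall_simple_smul_eq_zero fun S hS s => by
      rw [mul_assoc, mul_smul]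
      rcases hact S hS with h1 | h0
      · rw [h1, mul_smul, eq_sub_of_add_eq hef, sub_smul, h1, one_smul, sub_self, smul_zero]
      · rw [h0]
  have hunop : ∀ x : R, e.unop * x * f.unop = (f * MulOpposite.op x * e).unop := fun x => by
    simp [mul_assoc]
  refine mul_mul_eq_zero_of_mem_jacobson_mul_self hR (congrArg MulOpposite.unop he)
    (congrArg MulOpposite.unop hf) (congrArg MulOpposite.unop hef) (fun x => ?_) r
  rw [hunop]
  exact unop_mem_ringJacobson_mul_self (mul_mul_mem_jacobson_mul_self_of_subsingleton_ext
    (isSemisimpleRing_op_quotient_jacobson h) hf hef hfe hact hext _)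

end Main

theorem mainTheorem2 (R : Type u) [Ring R] [Nontrivial R] (hR : IsSemiperfectRing R)
    (h : IsTwoSidedNoetherianRing R ∨
      (IsLeftPerfectRing R ∧ IsRightPerfectRing R ∧
        IsTwoSidedNoetherianRing (R ⧸ (Ring.jacobson R ^ 2)))) :
    IsIndecomposableRing R ↔
      ∀ S T : ModuleCat.{u} Rᵐᵒᵖ, IsSimpleModule Rᵐᵒᵖ S → IsSimpleModule Rᵐᵒᵖ T →
        HasExtPath S T := by
  constructor
  · intro hind
    by_contra! hcon
    obtain ⟨S₀, T₀, hS₀, hT₀, hpath⟩ := hcon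
    have hss := isSemisimpleRing_op_quotient_jacobson hR.semilocal
    obtain ⟨e, he, hact⟩ := exists_separating_idempotent hss
      (exists_isIdempotentElem_op_of_lift hR.lift) (HasExtPath S₀) fun _ _ i hS => hS.trans_iso i
    have hact' : ∀ S : ModuleCat.{u} Rᵐᵒᵖ, IsSimpleModule Rᵐᵒᵖ S →
        (HasExtPath S₀ S ∧ ∀ s : S, e • s = s) ∨ (¬ HasExtPath S₀ S ∧ ∀ s : S, e • s = 0) :=
      fun S hS => by
        by_cases hP : HasExtPath S₀ S
        · exact Or.inl ⟨hP, (hact S hS).1 hP⟩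
        · exact Or.inr ⟨hP, (hact S hS).2 hP⟩
    have hext : ∀ S T : ModuleCat.{u} Rᵐᵒᵖ, IsSimpleModule Rᵐᵒᵖ S → IsSimpleModule Rᵐᵒᵖ T →
        HasExtPath S₀ S → ¬ HasExtPath S₀ T →
          Subsingleton (Abelian.Ext.{u} S T 1) ∧ Subsingleton (Abelian.Ext.{u} T S 1) :=
      fun S T _ hT hPS hPT => by
        simp only [← not_nontrivial_iff_subsingleton]
        exact ⟨fun hn => hPT (hPS.snoc hT (Or.inl hn)), fun hn => hPT (hPS.snoc hT (Or.inr hn))⟩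
    have hR' : IsTwoSidedNoetherianRing R ∨ (IsLeftPerfectRing R ∧ IsRightPerfectRing R) :=
      h.imp_right fun h => ⟨h.1, h.2.1⟩
    have hzero : ∀ S : ModuleCat.{u} Rᵐᵒᵖ, IsSimpleModule Rᵐᵒᵖ S → (∀ s : S, e • s = s) →
        ¬ ∀ s : S, e • s = 0 := fun S hS h1 h0 => by
      have := IsSimpleModule.nontrivial Rᵐᵒᵖ S
      obtain ⟨s, hs⟩ := exists_ne (0 : S)
      exact hs ((h1 s).symm.trans (h0 s))
    have hefR := unop_mul_mul_unop_eq_zero_of_subsingleton_ext hR' hR.semilocal he.one_sub he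
      (sub_add_cancel _ _) (fun S hS => (hact' S hS).imp And.right And.right)
      fun S T hS hT hS0 hT1 => (hext T S hT hS
        ((hact' T hT).resolve_right fun h' => hzero T hT hT1 h'.2).1
        ((hact' S hS).resolve_left fun h' => hzero S hS h'.2 hS0).1).2
    have hfeR := unop_mul_mul_unop_eq_zero_of_subsingleton_ext hR' hR.semilocal he he.one_sub
      (add_sub_cancel _ _) (fun S hS => by
        simp only [sub_smul, one_smul, sub_eq_self, sub_eq_zero]
        exact (hact' S hS).symm.imp And.right fun h' s => (h'.2 s).symm)
      fun S T hS hT hS0 hT1 => by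
        simp only [sub_smul, one_smul, sub_eq_self, sub_eq_zero] at hS0 hT1
        exact (hext S T hS hT
          ((hact' S hS).resolve_right fun h' => hzero S hS (fun s => (hS0 s).symm) h'.2).1
          ((hact' T hT).resolve_left fun h' => hzero T hT h'.2 hT1).1).1
    -- With both corners zero, `er = ere = re`.
    have hc : ∀ r, e.unop * r = r * e.unop := fun r => by
      have h₁ := hefR r
      have h₂ := hfeR r
      simp only [MulOpposite.unop_sub, MulOpposite.unop_one, sub_mul, mul_sub, one_mul, mul_one,
        sub_eq_zero] at h₁ h₂
      exact h₂.trans h₁.symm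
    have hS₀1 := (hact S₀ hS₀).1 (HasExtPath.of_iso (Iso.refl _) hS₀)
    have hT₀0 := (hact T₀ hT₀).2 hpath
    refine not_isIndecomposableRing_of_central_idempotent (congrArg MulOpposite.unop he) hc
      (fun h0 => hzero S₀ hS₀ hS₀1 fun s => ?_) (fun h1 => hzero T₀ hT₀ (fun s => ?_) hT₀0) hind
    · rw [show e = 0 from MulOpposite.unop_injective h0, zero_smul]
    · rw [show e = 1 from MulOpposite.unop_injective h1, one_smul]
  · intro hpath
    by_contra hind
    obtain ⟨e, he, hc, h0, h1⟩ := exists_central_idempotent_of_not_isIndecomposableRing hind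
    rcases eq_zero_or_one_of_central_idempotent_of_hasExtPath hpath (e := MulOpposite.op e)
      (congrArg MulOpposite.op he) (fun r => MulOpposite.unop_injective (hc r.unop).symm) with h | h
    · exact h0 (MulOpposite.op_injective h)
    · exact h1 (MulOpposite.op_injective h)
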